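/- **Theorem.** Let $\psi(s) = \dfrac{1 - s\cot s}{s^2}$, let $\vartheta_1$ be the unique solution of $\tan s = s$ in $(\pi, \tfrac32\pi)$, and for $v = (v_1, v_2) \in \mathbb R^2$ write $r = |v| = \sqrt{v_1^2+v_2^2}$ and $e_2 = (0,1)$. Put $$\Lambda(v) = v_2\Big[\frac{\psi'(r)}{r}\,v_2\,v + 2\psi(r)\,e_2\Big], \qquad \mathrm K_3(v) = 2\psi(r) + \frac{\psi'(r)}{r}\,v_2^2,$$ $$\Omega_{-,4} = \{ v \in \mathbb R^2 : v_2 < 0,\ \pi < v_1 < r < \vartheta_1,\ \mathrm K_3(v) < 0\},$$ $$\mathbb R^2_{<,+} = \Big\{ u \in \mathbb R^2 : u_1 > 0,\ 0 < u_2 < \tfrac{2}{\sqrt\pi}\sqrt{u_1}\Big\}.$$ For $x, t, \tau \in \mathbb R^3$ let $$\phi((x,t);\tau) = \langle U(\tau)\cot U(\tau)\,x, x\rangle + 4\,t\cdot\tau, \qquad U(\tau) = i\begin{pmatrix} 0 & \tau_3 & -\tau_2\\ -\tau_3 & 0 & \tau_1\\ \tau_2 & -\tau_1 & 0\end{pmatrix},$$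 where $U(\tau)\cot U(\tau)$ is the function $s \mapsto s\cot s$ (with value $1$ at $s=0$) of the Hermitian matrix $U(\tau)$; this is well defined whenever $|\tau| \notin \{\pi, 2\pi, 3\pi, \dots\}$. Then $\Omega_{-,4}$ and $\mathbb R^2_{<,+}$ are open and $\Lambda$ is a $C^\infty$-diffeomorphism from $\Omega_{-,4}$ onto $\mathbb R^2_{<,+}$. Furthermore, let $c > 0$ and $u \in \mathbb R^2_{<,+}$, and set $x = c\,(1,0,0)$, $t = \frac{c^2}{4}(u, 0)$ and $\theta = (\Lambda^{-1}(u), 0)$, where $\Lambda^{-1}$ is the inverse of $\Lambda|_{\Omega_{-,4}}$. Then $\phi((x,t);\cdot)$ is $C^\infty$ near $\theta$, and its $3\times 3$ Hessian matrix at $\theta$ is nonsingular and has exactly two positive eigenvalues (counted with multiplicity). -/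

import Mathlib

open Real Set
open scoped ContDiff Matrix

noncomputable section

namespace FreeStepTwo

/-- The function `ψ(s) = (1 - s cot s) / s ^ 2` (used below only at points `s > π` near which it is
smooth, never at its removable singularity `s = 0`). -/
def psi (s : ℝ) : ℝ := (1 - s * Real.cot s) / s ^ 2

/-- The equation `tan s = s` has exactly one solution in `(π, 3π/2)`. -/
theorem existsUnique_tan_eq_self :
    ∃! s : ℝ, s ∈ Ioo π (3 / 2 * π) ∧ Real.tan s = s := by
  have hpi := Real.pi_pos
  have hcos : ∀ s ∈ Ioo π (3 / 2 * π), Real.cos s < 0 := by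
    intro s hs
    apply Real.cos_neg_of_pi_div_two_lt_of_lt <;> linarith [hs.1, hs.2]
  have hiff : ∀ s ∈ Ioo π (3 / 2 * π),
      (Real.tan s = s ↔ Real.sin s - s * Real.cos s = 0) := by
    intro s hs
    rw [Real.tan_eq_sin_div_cos, div_eq_iff (hcos s hs).ne, sub_eq_zero]
  have hderiv : ∀ s : ℝ, HasDerivAt (fun s => Real.sin s - s * Real.cos s) (s * Real.sin s) s := by
    intro s
    have h := (Real.hasDerivAt_sin s).sub ((hasDerivAt_id s).mul (Real.hasDerivAt_cos s))
    refine h.congr_deriv ?_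
    simp only [id]
    ring
  have hcont : ContinuousOn (fun s : ℝ => Real.sin s - s * Real.cos s) (Icc π (3 / 2 * π)) := by
    fun_prop
  have hanti : StrictAntiOn (fun s : ℝ => Real.sin s - s * Real.cos s) (Icc π (3 / 2 * π)) := by
    apply strictAntiOn_of_deriv_neg (convex_Icc _ _) hcont
    intro s hs
    rw [interior_Icc] at hs
    rw [(hderiv s).deriv]
    have h1 : 0 < Real.sin (s - π) := Real.sin_pos_of_pos_of_lt_pi (by linarith [hs.1])
      (by linarith [hs.2])
    rw [Real.sin_sub_pi] at h1
    nlinarith [hs.1]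
  have h32c : Real.cos (3 / 2 * π) = 0 := by
    rw [show 3 / 2 * π = π / 2 + π by ring, Real.cos_add_pi, Real.cos_pi_div_two, neg_zero]
  have h32s : Real.sin (3 / 2 * π) = -1 := by
    rw [show 3 / 2 * π = π / 2 + π by ring, Real.sin_add_pi, Real.sin_pi_div_two]
  have hmem : (0 : ℝ) ∈ Ioo (Real.sin (3 / 2 * π) - 3 / 2 * π * Real.cos (3 / 2 * π))
      (Real.sin π - π * Real.cos π) := by
    rw [h32c, h32s, Real.sin_pi, Real.cos_pi]
    constructor <;> linarith
  obtain ⟨s, hs, hs0⟩ := intermediate_value_Ioo' (by linarith : π ≤ 3 / 2 * π) hcont hmem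
  refine ⟨s, ⟨hs, (hiff s hs).2 hs0⟩, ?_⟩
  rintro s' ⟨hs', ht'⟩
  exact hanti.injOn (Ioo_subset_Icc_self hs') (Ioo_subset_Icc_self hs)
    (((hiff s' hs').1 ht').trans hs0.symm)

/-- `ϑ₁`, the unique solution of `tan s = s` in `(π, 3π/2)`. -/
def vartheta1 : ℝ := Classical.choose existsUnique_tan_eq_self.exists

/-- `Λ(v) = v₂ [ (ψ'(r)/r) v₂ v + 2 ψ(r) e₂ ]`, with `r = |v|`. -/
def Lam (v : EuclideanSpace ℝ (Fin 2)) : EuclideanSpace ℝ (Fin 2) :=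
  v 1 • ((deriv psi ‖v‖ / ‖v‖ * v 1) • v + (2 * psi ‖v‖) • EuclideanSpace.single 1 1)

/-- `K₃(v) = 2 ψ(r) + (ψ'(r)/r) v₂²`, with `r = |v|`. -/
def K3 (v : EuclideanSpace ℝ (Fin 2)) : ℝ :=
  2 * psi ‖v‖ + deriv psi ‖v‖ / ‖v‖ * v 1 ^ 2

/-- The region `Ω_{-,4}`. -/
def OmegaMinusFour : Set (EuclideanSpace ℝ (Fin 2)) :=
  {v | v 1 < 0 ∧ π < v 0 ∧ v 0 < ‖v‖ ∧ ‖v‖ < vartheta1 ∧ K3 v < 0}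

/-- The region `ℝ²_{<,+}`. -/
def R2LtPos : Set (EuclideanSpace ℝ (Fin 2)) :=
  {u | 0 < u 0 ∧ 0 < u 1 ∧ u 1 < 2 / √π * √(u 0)}

/-- `f` restricts to a `C^∞` diffeomorphism from the open set `s` onto the open set `t`,
with inverse `g`. -/
structure IsSmoothDiffeoOn {E F : Type*} [NormedAddCommGroup E] [NormedSpace ℝ E]
    [NormedAddCommGroup F] [NormedSpace ℝ F] (f : E → F) (g : F → E) (s : Set E) (t : Set F) :
    Prop where
  isOpen_source : IsOpen s
  isOpen_target : IsOpen t
  bijOn : BijOn f s t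
  invOn : InvOn g f s t
  contDiffOn : ContDiffOn ℝ ∞ f s
  contDiffOn_inv : ContDiffOn ℝ ∞ g t

/-- The Hermitian matrix `U(τ) = i ∑ⱼ τⱼ U⁽ʲ⁾` of the free step-two group `N_{3,2}`. -/
def U (τ : EuclideanSpace ℝ (Fin 3)) : Matrix (Fin 3) (Fin 3) ℂ :=
  Complex.I • (!![0, τ 2, -τ 1; -τ 2, 0, τ 0; τ 1, -τ 0, 0] : Matrix (Fin 3) (Fin 3) ℝ).map
    (fun a : ℝ => (a : ℂ))

/-- The function `s ↦ s cot s`, with its limit `1` as value at `s = 0`. -/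
def sCot (s : ℝ) : ℝ := if s = 0 then 1 else s * Real.cot s

/-- The reference function `φ((x, t); τ) = ⟨U(τ) cot U(τ) x, x⟩ + 4 t · τ` on `N_{3,2} = ℝ³ × ℝ³`.
The matrix `U(τ) cot U(τ)` is given by the functional calculus of the Hermitian matrix `U(τ)`. -/
def phi (x t τ : EuclideanSpace ℝ (Fin 3)) : ℝ :=
  ((cfc sCot (U τ) *ᵥ fun i => (x i : ℂ)) ⬝ᵥ star (fun i => (x i : ℂ))).re + 4 * inner ℝ t τ

/-- The Hessian matrix `(∂ᵢ ∂ⱼ f (p))ᵢⱼ`. -/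
def hessian {n : ℕ} (f : EuclideanSpace ℝ (Fin n) → ℝ) (p : EuclideanSpace ℝ (Fin n)) :
    Matrix (Fin n) (Fin n) ℝ :=
  Matrix.of fun i j =>
    fderiv ℝ (fderiv ℝ f) p (EuclideanSpace.single i 1) (EuclideanSpace.single j 1)

/-- The embedding `v ↦ (v, 0)` of `ℝ²` into `ℝ³`. -/
def embed (v : EuclideanSpace ℝ (Fin 2)) : EuclideanSpace ℝ (Fin 3) := !₂[v 0, v 1, 0]

end FreeStepTwo

end

/-! Coordinates are numbered from 1 here. Local part: Λ is the gradient of v₂² ψ(|v|), and for x = c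
e₁ the functional calculus gives φ = c² (1 - ψ(|τ|)(τ₂² + τ₃²)) + 4 t·τ. Hence the Hessian of φ at
(v, 0) is -c² times the block matrix with blocks DΛ(v) and K₃(v). Everything local follows from det
DΛ < 0 on the region (`hess_det_neg`): Λ is a local diffeomorphism, the first block contributes one
eigenvalue of each sign, and -c² K₃ > 0 is the second positive one.

Global part: put s = |v|, let β = 1/(s cot s - 1), which increases from 0 at π to ∞ at ϑ₁, and let q
= v₂² T/(2 s² β) with T = `tpoly s`. Then K₃ < 0 means q < 1, and the region becomes the rectangle π
< s < ϑ₁, 0 < q < 1; the condition v₁ > π is automatic there by `pi_sq_mul_tpoly_lt`. The equation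
Λ(v) = u turns into `levelRatio s q` = u₂⁴/(16 u₁²) and `levelSq s q` = u₁²/4.

Uniqueness: `levelRatio` decreases in s and q, while `levelSq` decreases in s and increases in q.
Along a level curve of the first, q falls as s grows, so the second strictly decreases. Existence:
the bound on u₂ says that the level lies below `levelRatio π 0` = 1/π²; along the level curve
`levelSq` then runs from ∞ at s = π to 0 at q = 0. -/

namespace FreeStepTwo

/-! ### The function β on [π, ϑ₁) -/

lemma vartheta1_mem : vartheta1 ∈ Ioo π (3 / 2 * π) :=
  (Classical.choose_spec existsUnique_tan_eq_self.exists).1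

lemma tan_vartheta1 : Real.tan vartheta1 = vartheta1 :=
  (Classical.choose_spec existsUnique_tan_eq_self.exists).2

lemma cos_neg_of_mem {s : ℝ} (hs : s ∈ Ico π (3 / 2 * π)) : cos s < 0 := by
  have := pi_pos
  apply cos_neg_of_pi_div_two_lt_of_lt <;> linarith [hs.1, hs.2]

lemma sin_neg_of_mem {s : ℝ} (hs : s ∈ Ioc π (3 / 2 * π)) : sin s < 0 := by
  have := pi_pos
  have h : 0 < sin (s - π) := sin_pos_of_pos_of_lt_pi (by linarith [hs.1]) (by linarith [hs.2])
  rw [sin_sub_pi] at h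
  linarith

lemma hasDerivAt_mul_cos_sub_sin (s : ℝ) :
    HasDerivAt (fun s => s * cos s - sin s) (-(s * sin s)) s := by
  refine (((hasDerivAt_id s).mul (hasDerivAt_cos s)).sub (hasDerivAt_sin s)).congr_deriv ?_
  simp

lemma mul_cos_sub_sin_vartheta1 : vartheta1 * cos vartheta1 - sin vartheta1 = 0 := by
  have hc : cos vartheta1 ≠ 0 := (cos_neg_of_mem (Ioo_subset_Ico_self vartheta1_mem)).ne
  have h := tan_vartheta1
  rw [tan_eq_sin_div_cos, div_eq_iff hc] at h
  linarith

lemma mul_cos_sub_sin_neg {s : ℝ} (hs : s ∈ Ico π vartheta1) : s * cos s - sin s < 0 := by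
  have hpi := pi_pos
  have hth := vartheta1_mem
  have hmono : StrictMonoOn (fun s : ℝ => s * cos s - sin s) (Icc π (3 / 2 * π)) := by
    apply strictMonoOn_of_deriv_pos (convex_Icc _ _) (by fun_prop)
    intro x hx
    rw [interior_Icc] at hx
    rw [(hasDerivAt_mul_cos_sub_sin x).deriv]
    nlinarith [sin_neg_of_mem (Ioo_subset_Ioc_self hx), hx.1]
  have := hmono ⟨hs.1, by linarith [hs.2, hth.2]⟩ (Ioo_subset_Icc_self hth) hs.2
  simpa [mul_cos_sub_sin_vartheta1] using this

/-- The function `β(s) = 1 / (s cot s - 1)`, continued by `0` to `s = π`. -/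
noncomputable def beta (s : ℝ) : ℝ := sin s / (s * cos s - sin s)

lemma beta_pi : beta π = 0 := by simp [beta]

lemma beta_pos {s : ℝ} (hs : s ∈ Ioo π vartheta1) : 0 < beta s :=
  div_pos_of_neg_of_neg (sin_neg_of_mem ⟨hs.1, by linarith [hs.2, vartheta1_mem.2]⟩)
    (mul_cos_sub_sin_neg (Ioo_subset_Ico_self hs))

lemma beta_nonneg {s : ℝ} (hs : s ∈ Ico π vartheta1) : 0 ≤ beta s := by
  rcases hs.1.eq_or_lt with h | h
  · rw [← h, beta_pi]
  · exact (beta_pos ⟨h, hs.2⟩).le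

/-- This Riccati equation is the only differential information on β used later; its right-hand side
makes β increasing. -/
lemma hasDerivAt_beta {s : ℝ} (hs : s ∈ Ico π vartheta1) :
    HasDerivAt beta ((1 + beta s + s ^ 2 * beta s ^ 2) / s) s := by
  have hf := (mul_cos_sub_sin_neg hs).ne
  have hs0 : s ≠ 0 := (pi_pos.trans_le hs.1).ne'
  refine ((hasDerivAt_sin s).div (hasDerivAt_mul_cos_sub_sin s) hf).congr_deriv ?_
  rw [beta]
  set f := s * cos s - sin s with hfdef
  field_simp
  rw [hfdef]
  ring

lemma continuousOn_beta : ContinuousOn beta (Ico π vartheta1) := fun _ hs =>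
  (hasDerivAt_beta hs).continuousAt.continuousWithinAt

lemma strictMonoOn_beta : StrictMonoOn beta (Ico π vartheta1) := by
  apply strictMonoOn_of_deriv_pos (convex_Ico _ _) continuousOn_beta
  intro s hs
  rw [interior_Ico] at hs
  rw [(hasDerivAt_beta (Ioo_subset_Ico_self hs)).deriv]
  have := beta_pos hs
  have := pi_pos.trans hs.1
  positivity

/-- The denominator of β vanishes at ϑ₁ while the sine stays negative there. The inequality is
cleared of the denominator so that it extends continuously to ϑ₁. -/
lemma exists_lt_beta (K : ℝ) : ∃ s ∈ Ioo π vartheta1, K < beta s := by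
  have hth := vartheta1_mem
  have hc : ContinuousAt (fun s => K * (s * cos s - sin s) - sin s) vartheta1 := by fun_prop
  have h0 : 0 < K * (vartheta1 * cos vartheta1 - sin vartheta1) - sin vartheta1 := by
    rw [mul_cos_sub_sin_vartheta1]
    linarith [sin_neg_of_mem (Ioo_subset_Ioc_self hth)]
  have h1 : ∀ᶠ s in nhdsWithin vartheta1 (Iio vartheta1),
      0 < K * (s * cos s - sin s) - sin s :=
    (hc.eventually (lt_mem_nhds h0)).filter_mono nhdsWithin_le_nhds
  obtain ⟨s, hs, hs'⟩ := (h1.and (Ioo_mem_nhdsLT hth.1)).exists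
  refine ⟨s, hs', ?_⟩
  rw [beta, lt_div_iff_of_neg (mul_cos_sub_sin_neg (Ioo_subset_Ico_self hs'))]
  linarith

/-! ### ψ as a function of the squared norm -/

/-- The function `s cot s` in terms of `w = s ^ 2`. -/
noncomputable def cotw (w : ℝ) : ℝ := √w * cot √w

/-- The function `ψ(s)` in terms of `w = s ^ 2`. -/
noncomputable def psi0 (w : ℝ) : ℝ := (1 - cotw w) / w

/-- The derivative of `psi0`. -/
noncomputable def psi1 (w : ℝ) : ℝ := (cotw w ^ 2 + cotw w + w - 2) / (2 * w ^ 2)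

/-- The second derivative of `psi0`. -/
noncomputable def psi2 (w : ℝ) : ℝ :=
  (-2 * cotw w ^ 3 - 3 * cotw w ^ 2 - 3 * cotw w + 8 - (2 * cotw w + 3) * w) / (4 * w ^ 3)

/-- The set of squares of the positive numbers at which the cotangent is regular. -/
def regularSet : Set ℝ := {w | 0 < w ∧ sin √w ≠ 0}

lemma cotw_eq : cotw = fun w => √w * (cos √w / sin √w) := by
  funext w
  rw [cotw, cot_eq_cos_div_sin]

lemma hasDerivAt_cotw {w : ℝ} (hw : w ∈ regularSet) :
    HasDerivAt cotw ((cotw w - cotw w ^ 2 - w) / (2 * w)) w := by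
  obtain ⟨h0, h1⟩ := hw
  have hs : √w ≠ 0 := (sqrt_pos.2 h0).ne'
  have hq := hasDerivAt_sqrt h0.ne'
  have hd := hq.mul (((hasDerivAt_cos √w).comp w hq).div ((hasDerivAt_sin √w).comp w hq) h1)
  rw [cotw_eq]
  refine hd.congr_deriv ?_
  simp only [Function.comp, Pi.div_apply]
  have hsq : w = √w ^ 2 := (sq_sqrt h0.le).symm
  generalize √w = s at *
  subst hsq
  field_simp
  ring

lemma hasDerivAt_psi0 {w : ℝ} (hw : w ∈ regularSet) : HasDerivAt psi0 (psi1 w) w := by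
  have hw0 := hw.1.ne'
  refine (((hasDerivAt_cotw hw).const_sub 1).div (hasDerivAt_id w) hw0).congr_deriv ?_
  simp only [psi1, id]
  field_simp
  ring

lemma hasDerivAt_psi1 {w : ℝ} (hw : w ∈ regularSet) : HasDerivAt psi1 (psi2 w) w := by
  have hw0 := hw.1.ne'
  have h := hasDerivAt_cotw hw
  refine (((((h.pow 2).add h).add (hasDerivAt_id w)).sub_const 2).div
    (((hasDerivAt_id w).pow 2).const_mul 2) (by simpa using hw0)).congr_deriv ?_
  simp only [psi2, id]
  field_simp
  simp
  ring

lemma contDiffAt_cotw {w : ℝ} (hw : w ∈ regularSet) : ContDiffAt ℝ ∞ cotw w := by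
  rw [cotw_eq]
  have hq : ContDiffAt ℝ ∞ (fun w => √w) w := contDiffAt_id.sqrt hw.1.ne'
  exact hq.mul (hq.cos.div hq.sin hw.2)

lemma contDiffAt_psi0 {w : ℝ} (hw : w ∈ regularSet) : ContDiffAt ℝ ∞ psi0 w :=
  (contDiffAt_const.sub (contDiffAt_cotw hw)).div contDiffAt_id hw.1.ne'

lemma contDiffAt_psi1 {w : ℝ} (hw : w ∈ regularSet) : ContDiffAt ℝ ∞ psi1 w :=
  (((((contDiffAt_cotw hw).pow 2).add (contDiffAt_cotw hw)).add contDiffAt_id).sub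
    contDiffAt_const).div (contDiffAt_const.mul (contDiffAt_id.pow 2))
    (mul_ne_zero two_ne_zero (pow_ne_zero 2 hw.1.ne'))

lemma psi_eq {s : ℝ} (hs : 0 ≤ s) : psi s = psi0 (s ^ 2) := by
  rw [psi, psi0, cotw, sqrt_sq hs]

/-- This turns ψ'(r)/r into `2 * psi1 (r ^ 2)`, so that Λ becomes polynomial in the coordinates and
functions of the smooth quantity ‖v‖². -/
lemma deriv_psi {s : ℝ} (hs : 0 < s) (h : sin s ≠ 0) : deriv psi s = 2 * s * psi1 (s ^ 2) := by
  have hw : s ^ 2 ∈ regularSet := ⟨by positivity, by rwa [sqrt_sq hs.le]⟩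
  have h1 : HasDerivAt (fun s => psi0 (s ^ 2)) (psi1 (s ^ 2) * (2 * s)) s := by
    have h2 : HasDerivAt (fun s : ℝ => s ^ 2) (2 * s) s := by simpa using hasDerivAt_pow 2 s
    exact HasDerivAt.comp (h := fun s : ℝ => s ^ 2) s (hasDerivAt_psi0 hw) h2
  have h2 : psi =ᶠ[nhds s] fun s => psi0 (s ^ 2) := by
    filter_upwards [lt_mem_nhds hs] with x hx using psi_eq hx.le
  rw [h2.deriv_eq, h1.deriv]
  ring

lemma sq_mem_regularSet {s : ℝ} (hs : s ∈ Ioo π vartheta1) : s ^ 2 ∈ regularSet := by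
  have h0 := pi_pos.trans hs.1
  refine ⟨by positivity, ?_⟩
  rw [sqrt_sq h0.le]
  exact (sin_neg_of_mem ⟨hs.1, by linarith [hs.2, vartheta1_mem.2]⟩).ne

lemma cotw_sq {s : ℝ} (hs : s ∈ Ioo π vartheta1) : cotw (s ^ 2) = 1 + 1 / beta s := by
  have h0 := pi_pos.trans hs.1
  have h1 := (sq_mem_regularSet hs).2
  have h2 := (mul_cos_sub_sin_neg (Ioo_subset_Ico_self hs)).ne
  rw [cotw, sqrt_sq h0.le] at *
  rw [cot_eq_cos_div_sin, beta]
  field_simp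
  ring

lemma psi0_sq {s : ℝ} (hs : s ∈ Ioo π vartheta1) : psi0 (s ^ 2) = -1 / (s ^ 2 * beta s) := by
  have := (pi_pos.trans hs.1).ne'
  have := (beta_pos hs).ne'
  rw [psi0, cotw_sq hs]
  field_simp
  ring

lemma psi1_sq {s : ℝ} (hs : s ∈ Ioo π vartheta1) :
    psi1 (s ^ 2) =
      (1 + 3 * beta s + s ^ 2 * beta s ^ 2) / (2 * (s ^ 2) ^ 2 * beta s ^ 2) := by
  have := (pi_pos.trans hs.1).ne'
  have := (beta_pos hs).ne'
  rw [psi1, cotw_sq hs]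
  field_simp
  ring

/-! ### Monotonicity of the two level functions -/

/-- The function `1 + 3 β + s² β²`, twice the derivative of `s² β(s)` with respect to `s²`. -/
noncomputable def tpoly (s : ℝ) : ℝ := 1 + 3 * beta s + s ^ 2 * beta s ^ 2

/-- The function `1 + (3 - 2 q) β + s² β²`. -/
noncomputable def rpoly (s q : ℝ) : ℝ := 1 + (3 - 2 * q) * beta s + s ^ 2 * beta s ^ 2

/-- The function of `(s, q)` that is to equal `u₂⁴ / (16 u₁²)`. -/
noncomputable def levelRatio (s q : ℝ) : ℝ := (1 - q) ^ 4 / (s ^ 2 * tpoly s * rpoly s q)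

/-- The function of `(s, q)` that is to equal `u₁² / 4`. -/
noncomputable def levelSq (s q : ℝ) : ℝ := q ^ 2 * rpoly s q / (s ^ 2 * beta s ^ 2 * tpoly s)

lemma one_le_tpoly {s : ℝ} (hs : s ∈ Ico π vartheta1) : 1 ≤ tpoly s := by
  have := beta_nonneg hs
  have : 0 ≤ 3 * beta s + s ^ 2 * beta s ^ 2 := by positivity
  rw [tpoly]
  linarith

lemma one_le_rpoly {s q : ℝ} (hs : s ∈ Ico π vartheta1) (hq : q ≤ 1) : 1 ≤ rpoly s q := by
  have := beta_nonneg hs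
  have h3 : 0 ≤ 3 - 2 * q := by linarith
  have : 0 ≤ (3 - 2 * q) * beta s + s ^ 2 * beta s ^ 2 := by positivity
  rw [rpoly]
  linarith

lemma tpoly_pi : tpoly π = 1 := by simp [tpoly, beta_pi]

lemma rpoly_pi (q : ℝ) : rpoly π q = 1 := by simp [rpoly, beta_pi]

lemma tpoly_strictMonoOn : StrictMonoOn tpoly (Ico π vartheta1) := by
  intro s hs s' hs' h
  have h0 := beta_nonneg hs
  have h1 := strictMonoOn_beta hs hs' h
  have h2 : 0 < s := pi_pos.trans_le hs.1
  have h3 : s ^ 2 * beta s ^ 2 ≤ s' ^ 2 * beta s' ^ 2 := by gcongr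
  simp only [tpoly]
  linarith

lemma rpoly_lt_of_lt {s s' q : ℝ} (hs : s ∈ Ico π vartheta1) (hs' : s' ∈ Ico π vartheta1)
    (h : s < s') (hq : q ≤ 1) : rpoly s q < rpoly s' q := by
  have h0 := beta_nonneg hs
  have h1 := strictMonoOn_beta hs hs' h
  have h2 : 0 < s := pi_pos.trans_le hs.1
  have h3 : s ^ 2 * beta s ^ 2 ≤ s' ^ 2 * beta s' ^ 2 := by gcongr
  have h4 : (3 - 2 * q) * beta s < (3 - 2 * q) * beta s' :=
    mul_lt_mul_of_pos_left h1 (by linarith)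
  simp only [rpoly]
  linarith

lemma continuousOn_tpoly : ContinuousOn tpoly (Ico π vartheta1) := by
  unfold tpoly
  have := continuousOn_beta
  fun_prop

lemma levelRatio_lt_of_lt {s s' q : ℝ} (hs : s ∈ Ico π vartheta1) (hs' : s' ∈ Ico π vartheta1)
    (h : s < s') (hq : q < 1) : levelRatio s' q < levelRatio s q := by
  have h1 := tpoly_strictMonoOn hs hs' h
  have h2 := rpoly_lt_of_lt hs hs' h hq.le
  have h3 := one_le_tpoly hs
  have h4 := one_le_rpoly hs hq.le
  have h5 : 0 < s := pi_pos.trans_le hs.1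
  have h6 : 0 < 1 - q := by linarith
  unfold levelRatio
  gcongr

/-- The denominator also decreases in q, so one factor `1 - q` is spent to compensate: `(1 - q) /
rpoly s q` is decreasing because `tpoly s > 2 * beta s`. -/
lemma levelRatio_strictAntiOn {s : ℝ} (hs : s ∈ Ico π vartheta1) :
    StrictAntiOn (levelRatio s) (Icc 0 1) := by
  intro q hq q' hq' h
  have h1 := one_le_tpoly hs
  have h2 := one_le_rpoly hs hq.2
  have h3 := one_le_rpoly hs hq'.2
  have h4 : 0 < s := pi_pos.trans_le hs.1
  have h5 := beta_nonneg hs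
  have h6 : (1 - q') * rpoly s q < (1 - q) * rpoly s q' := by
    have h8 : 0 < tpoly s - 2 * beta s := by
      have : 0 ≤ s ^ 2 * beta s ^ 2 := by positivity
      rw [tpoly]
      linarith
    have h7 : (1 - q) * rpoly s q' - (1 - q') * rpoly s q =
        (q' - q) * (tpoly s - 2 * beta s) := by
      simp only [rpoly, tpoly]
      ring
    have := mul_pos (sub_pos.2 h) h8
    linarith
  have h7 : (1 - q') ^ 3 ≤ (1 - q) ^ 3 := by
    have : 0 ≤ 1 - q' := by linarith [hq'.2]
    gcongr
  have h8 : 0 < (1 - q) ^ 3 := by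
    have : 0 < 1 - q := by linarith [hq'.2]
    positivity
  have h9 : 0 ≤ (1 - q') * rpoly s q := mul_nonneg (by linarith [hq'.2]) (by linarith)
  unfold levelRatio
  rw [div_lt_div_iff₀ (by positivity) (by positivity)]
  have h10 : (1 - q') ^ 4 * rpoly s q < (1 - q) ^ 4 * rpoly s q' := by
    calc (1 - q') ^ 4 * rpoly s q = (1 - q') ^ 3 * ((1 - q') * rpoly s q) := by ring
      _ ≤ (1 - q) ^ 3 * ((1 - q') * rpoly s q) := by gcongr
      _ < (1 - q) ^ 3 * ((1 - q) * rpoly s q') := by gcongr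
      _ = (1 - q) ^ 4 * rpoly s q' := by ring
  have h11 : 0 < s ^ 2 * tpoly s := by positivity
  calc (1 - q') ^ 4 * (s ^ 2 * tpoly s * rpoly s q)
      = s ^ 2 * tpoly s * ((1 - q') ^ 4 * rpoly s q) := by ring
    _ < s ^ 2 * tpoly s * ((1 - q) ^ 4 * rpoly s q') := by gcongr
    _ = _ := by ring

lemma levelSq_lt_of_lt {s s' q : ℝ} (hs : s ∈ Ioo π vartheta1) (hs' : s' ∈ Ioo π vartheta1)
    (h : s < s') (hq : q ∈ Ioc 0 1) : levelSq s' q < levelSq s q := by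
  have hs0 := Ioo_subset_Ico_self hs
  have hs0' := Ioo_subset_Ico_self hs'
  -- Dividing `rpoly` by s² β² leaves a numerator that decreases in s, over the increasing `tpoly`.
  have key : ∀ s ∈ Ioo π vartheta1, levelSq s q =
      q ^ 2 * (1 + 1 / (s ^ 2 * beta s ^ 2) + (3 - 2 * q) / (s ^ 2 * beta s)) / tpoly s := by
    intro s hs
    have := (beta_pos hs).ne'
    have := (pi_pos.trans hs.1).ne'
    have := (one_pos.trans_le (one_le_tpoly (Ioo_subset_Ico_self hs))).ne'
    rw [levelSq, rpoly]
    field_simp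
    ring
  rw [key s hs, key s' hs']
  have h1 := tpoly_strictMonoOn hs0 hs0' h
  have h2 := one_le_tpoly hs0
  have h3 := beta_pos hs
  have h4 := strictMonoOn_beta hs0 hs0' h
  have h5 : 0 < s := pi_pos.trans hs.1
  have h6 : 0 < 3 - 2 * q := by linarith [hq.2]
  have h7 := hq.1
  have h8 := beta_pos hs'
  gcongr

lemma levelSq_lt_of_lt_right {s q q' : ℝ} (hs : s ∈ Ioo π vartheta1) (hq : 0 ≤ q) (h : q < q')
    (hq' : q' ≤ 1) : levelSq s q < levelSq s q' := by
  have h1 := beta_pos hs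
  have h2 : 0 < s := pi_pos.trans hs.1
  have h3 := one_le_tpoly (Ioo_subset_Ico_self hs)
  have h4 : q ^ 2 * rpoly s q < q' ^ 2 * rpoly s q' := by
    have e : q' ^ 2 * rpoly s q' - q ^ 2 * rpoly s q = (q' - q) * ((q' + q) *
        (1 + s ^ 2 * beta s ^ 2) + beta s * (3 * (q' + q) - 2 * (q' ^ 2 + q' * q + q ^ 2))) := by
      simp only [rpoly]
      ring
    -- This is the difference quotient of 3q² - 2q³, which is increasing on [0, 1].
    have h5 : 0 ≤ 3 * (q' + q) - 2 * (q' ^ 2 + q' * q + q ^ 2) := by nlinarith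
    have h6 : 0 < q' + q := by linarith
    have h7 : 0 < q' - q := by linarith
    have : 0 < q' ^ 2 * rpoly s q' - q ^ 2 * rpoly s q := by
      rw [e]
      positivity
    linarith
  unfold levelSq
  gcongr

lemma level_unique {s s' q q' : ℝ} (hs : s ∈ Ioo π vartheta1) (hs' : s' ∈ Ioo π vartheta1)
    (hq : q ∈ Ioo 0 1) (hq' : q' ∈ Ioo 0 1) (h1 : levelRatio s q = levelRatio s' q')
    (h2 : levelSq s q = levelSq s' q') : s = s' ∧ q = q' := by
  have key : ∀ {s s' q q' : ℝ}, s ∈ Ioo π vartheta1 → s' ∈ Ioo π vartheta1 →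
      q ∈ Ioo (0 : ℝ) 1 → q' ∈ Ioo (0 : ℝ) 1 → levelRatio s q = levelRatio s' q' →
      levelSq s q = levelSq s' q' → ¬ s < s' := by
    intro s s' q q' hs hs' hq hq' h1 h2 h
    have h3 := levelRatio_lt_of_lt (Ioo_subset_Ico_self hs) (Ioo_subset_Ico_self hs') h hq.2
    have h4 := levelSq_lt_of_lt hs hs' h (Ioo_subset_Ioc_self hq)
    rcases le_or_gt q q' with h5 | h5
    · have := (levelRatio_strictAntiOn (Ioo_subset_Ico_self hs')).antitoneOn
        (Ioo_subset_Icc_self hq) (Ioo_subset_Icc_self hq') h5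
      linarith
    · have := levelSq_lt_of_lt_right hs' hq'.1.le h5 hq.2.le
      linarith
  have hss : s = s' := le_antisymm (not_lt.1 (key hs' hs hq' hq h1.symm h2.symm))
    (not_lt.1 (key hs hs' hq hq' h1 h2))
  subst hss
  exact ⟨rfl, (levelRatio_strictAntiOn (Ioo_subset_Ico_self hs)).injOn
    (Ioo_subset_Icc_self hq) (Ioo_subset_Icc_self hq') h1⟩

/-! ### Existence of an intersection of the level curves -/

/-- The solution in the second variable of an equation that is strictly antitone in this variable
depends continuously on the first variable. -/
lemma continuousOn_of_strictAntiOn {f : ℝ → ℝ → ℝ} {g : ℝ → ℝ} {I : Set ℝ} {a b k : ℝ}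
    (hf : ∀ y ∈ Icc a b, ContinuousOn (fun x => f x y) I)
    (hanti : ∀ x ∈ I, StrictAntiOn (f x) (Icc a b)) (hg : ∀ x ∈ I, g x ∈ Icc a b)
    (hk : ∀ x ∈ I, f x (g x) = k) : ContinuousOn g I := by
  intro x hx
  refine tendsto_order.2 ⟨fun y hy => ?_, fun y hy => ?_⟩
  · rcases lt_or_ge y a with h | h
    · filter_upwards [self_mem_nhdsWithin] with z hz using h.trans_le (hg z hz).1
    · have hyI : y ∈ Icc a b := ⟨h, hy.le.trans (hg x hx).2⟩
      have h1 : k < f x y := by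
        rw [← hk x hx]
        exact hanti x hx hyI (hg x hx) hy
      filter_upwards [self_mem_nhdsWithin, (hf y hyI x hx).eventually (lt_mem_nhds h1)]
        with z hz h2
      rw [← hk z hz] at h2
      exact ((hanti z hz).lt_iff_gt (hg z hz) hyI).1 h2
  · rcases lt_or_ge b y with h | h
    · filter_upwards [self_mem_nhdsWithin] with z hz using (hg z hz).2.trans_lt h
    · have hyI : y ∈ Icc a b := ⟨(hg x hx).1.trans hy.le, h⟩
      have h1 : f x y < k := by
        rw [← hk x hx]
        exact hanti x hx (hg x hx) hyI hy
      filter_upwards [self_mem_nhdsWithin, (hf y hyI x hx).eventually (gt_mem_nhds h1)]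
        with z hz h2
      rw [← hk z hz] at h2
      exact ((hanti z hz).lt_iff_gt hyI (hg z hz)).1 h2

lemma level_exists {k m : ℝ} (hk : 0 < k) (hk' : k < 1 / π ^ 2) (hm : 0 < m) :
    ∃ s ∈ Ioo π vartheta1, ∃ q ∈ Ioo (0 : ℝ) 1, levelRatio s q = k ∧ levelSq s q = m := by
  have hpi := pi_pos
  have hcont : ∀ y ∈ Icc (0 : ℝ) 1, ContinuousOn (fun x => levelRatio x y) (Ico π vartheta1) := by
    intro y hy
    have h1 := continuousOn_beta
    have h2 := continuousOn_tpoly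
    unfold levelRatio
    refine ContinuousOn.div (by fun_prop) (by unfold rpoly; fun_prop) fun x hx => ?_
    have := one_le_tpoly hx
    have := one_le_rpoly hx hy.2
    have := pi_pos.trans_le hx.1
    positivity
  -- At q = 0 the ratio is 1/(s² T²) with T ≥ β and T ≥ 1, so β > 1/k pushes it below k.
  obtain ⟨s₁, hs₁, hb⟩ := exists_lt_beta (1 / k)
  have hs₁' := Ioo_subset_Ico_self hs₁
  have hr₁ : levelRatio s₁ 0 < k := by
    have h1 := one_le_tpoly hs₁'
    have h2 : rpoly s₁ 0 = tpoly s₁ := by simp [rpoly, tpoly]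
    have h3 : beta s₁ ≤ tpoly s₁ := by
      have := beta_pos hs₁
      have : 0 ≤ s₁ ^ 2 * beta s₁ ^ 2 := by positivity
      rw [tpoly]
      linarith
    have h4 : 1 ≤ s₁ := by linarith [hs₁.1, pi_gt_three]
    have h5 : 1 / k < s₁ ^ 2 * tpoly s₁ * tpoly s₁ := by
      calc 1 / k < 1 * 1 * tpoly s₁ := by linarith
        _ ≤ s₁ ^ 2 * tpoly s₁ * tpoly s₁ := by gcongr; exact one_le_pow₀ h4
    rw [levelRatio, h2, sub_zero, one_pow]
    exact (one_div_lt hk (by positivity)).1 h5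
  have hrpi : levelRatio π 0 = 1 / π ^ 2 := by simp [levelRatio, tpoly_pi, rpoly_pi]
  have hsub : Icc π s₁ ⊆ Ico π vartheta1 := fun x hx => ⟨hx.1, hx.2.trans_lt hs₁.2⟩
  -- The level curve through k meets the edge q = 0 at s₂, and is a graph over [π, s₂].
  obtain ⟨s₂, hs₂, hr₂⟩ := intermediate_value_Ioo' hs₁.1.le
    ((hcont 0 (by simp)).mono hsub) (show k ∈ Ioo (levelRatio s₁ 0) (levelRatio π 0) by
      rw [hrpi]; exact ⟨hr₁, hk'⟩)
  replace hr₂ : levelRatio s₂ 0 = k := hr₂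
  have hsub₂ : Icc π s₂ ⊆ Ico π vartheta1 := fun x hx => hsub ⟨hx.1, hx.2.trans hs₂.2.le⟩
  have hex : ∀ s ∈ Icc π s₂, ∃ q ∈ Icc (0 : ℝ) 1, levelRatio s q = k := by
    intro s hs
    have h1 : k ≤ levelRatio s 0 := by
      rcases hs.2.eq_or_lt with h | h
      · rw [h, hr₂]
      · rw [← hr₂]
        exact (levelRatio_lt_of_lt (hsub₂ hs) (hsub₂ ⟨hs₂.1.le, le_rfl⟩) h one_pos).le
    have h2 : levelRatio s 1 ≤ k := by simpa [levelRatio] using hk.le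
    have h3 : ContinuousOn (levelRatio s) (Icc 0 1) := by
      unfold levelRatio
      refine ContinuousOn.div (by fun_prop) (by unfold rpoly; fun_prop) fun y hy => ?_
      have := one_le_tpoly (hsub₂ hs)
      have := one_le_rpoly (hsub₂ hs) hy.2
      have := pi_pos.trans_le hs.1
      positivity
    exact intermediate_value_Icc' zero_le_one h3 ⟨h2, h1⟩
  choose! q hq hqk using hex
  have hq1 : ∀ s ∈ Icc π s₂, q s < 1 := fun s hs => (hq s hs).2.lt_of_ne fun h => by
    have := hqk s hs
    rw [h] at this
    simp [levelRatio] at this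
    exact hk.ne this
  have hqc : ContinuousOn q (Icc π s₂) :=
    continuousOn_of_strictAntiOn (fun y hy => (hcont y hy).mono hsub₂)
      (fun x hx => levelRatio_strictAntiOn (hsub₂ hx)) hq hqk
  have hpimem : π ∈ Icc π s₂ := ⟨le_rfl, hs₂.1.le⟩
  have hs₂mem : s₂ ∈ Icc π s₂ := ⟨hs₂.1.le, le_rfl⟩
  have hq₂ : q s₂ = 0 := (levelRatio_strictAntiOn (hsub₂ hs₂mem)).injOn (hq s₂ hs₂mem)
    (by simp) ((hqk s₂ hs₂mem).trans hr₂.symm)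
  have hqpi : 0 < q π := (hq π hpimem).1.lt_of_ne fun h => by
    have := hqk π hpimem
    rw [← h, hrpi] at this
    exact hk'.ne' this
  -- The equation `levelSq s q = m` is cleared of its denominator, which vanishes at π.
  have hEc : ContinuousOn (fun s => q s ^ 2 * rpoly s (q s) -
      m * (s ^ 2 * beta s ^ 2 * tpoly s)) (Icc π s₂) := by
    have h1 := continuousOn_beta.mono hsub₂
    have h2 := continuousOn_tpoly.mono hsub₂
    unfold rpoly
    fun_prop
  have hb₂ : 0 < beta s₂ := beta_pos ⟨hs₂.1, (hsub₂ hs₂mem).2⟩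
  have hpos : ∀ s ∈ Ioc π s₂, 0 < m * (s ^ 2 * beta s ^ 2 * tpoly s) := by
    intro s hs
    have h1 := hsub₂ (Ioc_subset_Icc_self hs)
    have := beta_pos ⟨hs.1, h1.2⟩
    have := one_le_tpoly h1
    have := pi_pos.trans hs.1
    positivity
  obtain ⟨s, hs, hE⟩ := intermediate_value_Ioo' hs₂.1.le hEc (show (0 : ℝ) ∈ Ioo _ _ by
    constructor
    · simpa [hq₂] using hpos s₂ ⟨hs₂.1, le_rfl⟩
    · simpa [beta_pi, rpoly_pi] using pow_pos hqpi 2)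
  replace hE : q s ^ 2 * rpoly s (q s) - m * (s ^ 2 * beta s ^ 2 * tpoly s) = 0 := hE
  have hsm := Ioo_subset_Icc_self hs
  have hp := hpos s (Ioo_subset_Ioc_self hs)
  refine ⟨s, ⟨hs.1, (hsub₂ hsm).2⟩, q s, ⟨(hq s hsm).1.lt_of_ne fun h => ?_, hq1 s hsm⟩,
    hqk s hsm, ?_⟩
  · rw [← h] at hE
    simp only [ne_eq, OfNat.ofNat_ne_zero, not_false_eq_true, zero_pow, zero_mul] at hE
    linarith
  · rw [levelSq, div_eq_iff]
    · linarith
    · exact fun h => by simp [h] at hp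

/-- Since (x² β)' = x `tpoly x`, the function `tpoly s` x² - 2x² β(x) has derivative 2x (`tpoly s` -
`tpoly x`) > 0 for π < x < s, and β(π) = 0. It yields `π < v 0` in the proof of surjectivity. -/
lemma pi_sq_mul_tpoly_lt {s : ℝ} (hs : s ∈ Ioo π vartheta1) :
    π ^ 2 * tpoly s < s ^ 2 * tpoly s - 2 * s ^ 2 * beta s := by
  have hsub : Icc π s ⊆ Ico π vartheta1 := fun x hx => ⟨hx.1, hx.2.trans_lt hs.2⟩
  have hd : ∀ x ∈ Icc π s, HasDerivAt (fun x => tpoly s * x ^ 2 - 2 * (x ^ 2 * beta x))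
      (2 * x * (tpoly s - tpoly x)) x := by
    intro x hx
    have hx0 := (pi_pos.trans_le hx.1).ne'
    refine (((hasDerivAt_pow 2 x).const_mul (tpoly s)).sub
      (((hasDerivAt_pow 2 x).mul (hasDerivAt_beta (hsub hx))).const_mul 2)).congr_deriv ?_
    simp only [tpoly]
    field_simp
    ring
  have hmono : StrictMonoOn (fun x => tpoly s * x ^ 2 - 2 * (x ^ 2 * beta x)) (Icc π s) := by
    apply strictMonoOn_of_deriv_pos (convex_Icc _ _)
      (fun x hx => (hd x hx).continuousAt.continuousWithinAt)
    intro x hx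
    rw [interior_Icc] at hx
    rw [(hd x (Ioo_subset_Icc_self hx)).deriv]
    have h1 := tpoly_strictMonoOn (hsub (Ioo_subset_Icc_self hx)) (Ioo_subset_Ico_self hs) hx.2
    have h2 := pi_pos.trans hx.1
    have h3 := sub_pos.2 h1
    positivity
  have := hmono ⟨le_rfl, hs.1.le⟩ ⟨hs.1.le, le_rfl⟩ hs.1
  simp only [beta_pi] at this
  linarith

/-! ### Λ in the coordinates (s, q), and its bijectivity -/

lemma norm_sq_two (v : EuclideanSpace ℝ (Fin 2)) : ‖v‖ ^ 2 = v 0 ^ 2 + v 1 ^ 2 := by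
  rw [EuclideanSpace.real_norm_sq_eq, Fin.sum_univ_two]

lemma deriv_psi_div {s : ℝ} (hs : s ∈ Ioo π vartheta1) :
    deriv psi s / s = 2 * psi1 (s ^ 2) := by
  have h0 := pi_pos.trans hs.1
  have h1 := (sq_mem_regularSet hs).2
  rw [sqrt_sq h0.le] at h1
  rw [deriv_psi h0 h1]
  field_simp

lemma Lam_zero {v : EuclideanSpace ℝ (Fin 2)} (hv : ‖v‖ ∈ Ioo π vartheta1) :
    Lam v 0 = 2 * psi1 (‖v‖ ^ 2) * v 1 ^ 2 * v 0 := by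
  simp [Lam, deriv_psi_div hv]
  ring

lemma Lam_one {v : EuclideanSpace ℝ (Fin 2)} (hv : ‖v‖ ∈ Ioo π vartheta1) :
    Lam v 1 = 2 * v 1 * (psi0 (‖v‖ ^ 2) + v 1 ^ 2 * psi1 (‖v‖ ^ 2)) := by
  simp [Lam, deriv_psi_div hv, psi_eq (norm_nonneg v)]
  ring

lemma K3_eq {v : EuclideanSpace ℝ (Fin 2)} (hv : ‖v‖ ∈ Ioo π vartheta1) :
    K3 v = 2 * (psi0 (‖v‖ ^ 2) + v 1 ^ 2 * psi1 (‖v‖ ^ 2)) := by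
  rw [K3, deriv_psi_div hv, psi_eq (norm_nonneg v)]
  ring

/-- The condition `v 0 < ‖v‖` can be dropped because it follows from `v 1 < 0`; what remains of it
is `π < ‖v‖`. -/
lemma mem_OmegaMinusFour_iff {v : EuclideanSpace ℝ (Fin 2)} :
    v ∈ OmegaMinusFour ↔ ‖v‖ ∈ Ioo π vartheta1 ∧ v 1 < 0 ∧ π < v 0 ∧
      psi0 (‖v‖ ^ 2) + v 1 ^ 2 * psi1 (‖v‖ ^ 2) < 0 := by
  constructor
  · rintro ⟨h1, h2, h3, h4, h5⟩
    have h : ‖v‖ ∈ Ioo π vartheta1 := ⟨h2.trans h3, h4⟩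
    rw [K3_eq h] at h5
    exact ⟨h, h1, h2, by linarith⟩
  · rintro ⟨h, h1, h2, h5⟩
    refine ⟨h1, h2, ?_, h.2, by rw [K3_eq h]; linarith⟩
    have := norm_sq_two v
    apply lt_of_pow_lt_pow_left₀ 2 (norm_nonneg v)
    nlinarith

lemma isOpen_norm_mem_Ioo (a b : ℝ) :
    IsOpen {v : EuclideanSpace ℝ (Fin 2) | ‖v‖ ∈ Ioo a b} :=
  isOpen_Ioo.preimage continuous_norm

lemma isOpen_OmegaMinusFour : IsOpen OmegaMinusFour := by
  have h1 : OmegaMinusFour = {v : EuclideanSpace ℝ (Fin 2) | v 1 < 0} ∩ {v | π < v 0} ∩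
      ({v | ‖v‖ ∈ Ioo π vartheta1} ∩
        (fun v => psi0 (‖v‖ ^ 2) + v 1 ^ 2 * psi1 (‖v‖ ^ 2)) ⁻¹' Iio 0) := by
    ext v
    rw [mem_OmegaMinusFour_iff]
    simp only [mem_inter_iff, mem_ofPred_eq, mem_preimage, mem_Iio]
    tauto
  rw [h1]
  refine ((isOpen_lt (by fun_prop) (by fun_prop)).inter
    (isOpen_lt (by fun_prop) (by fun_prop))).inter
    (ContinuousOn.isOpen_inter_preimage ?_ (isOpen_norm_mem_Ioo _ _) isOpen_Iio)
  intro v hv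
  have hw := sq_mem_regularSet hv
  have hn : ContinuousAt (fun v : EuclideanSpace ℝ (Fin 2) => ‖v‖ ^ 2) v := by fun_prop
  have h2 : ContinuousAt (fun v : EuclideanSpace ℝ (Fin 2) => psi0 (‖v‖ ^ 2)) v :=
    ContinuousAt.comp (f := fun v : EuclideanSpace ℝ (Fin 2) => ‖v‖ ^ 2)
      (hasDerivAt_psi0 hw).continuousAt hn
  have h3 : ContinuousAt (fun v : EuclideanSpace ℝ (Fin 2) => psi1 (‖v‖ ^ 2)) v :=
    ContinuousAt.comp (f := fun v : EuclideanSpace ℝ (Fin 2) => ‖v‖ ^ 2)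
      (hasDerivAt_psi1 hw).continuousAt hn
  have h4 : ContinuousAt (fun v : EuclideanSpace ℝ (Fin 2) => v 1 ^ 2) v := by fun_prop
  exact (h2.add (h4.mul h3)).continuousWithinAt

lemma isOpen_R2LtPos : IsOpen R2LtPos := by
  simp only [R2LtPos, ofPred_and]
  exact (isOpen_lt (by fun_prop) (by fun_prop)).inter
    ((isOpen_lt (by fun_prop) (by fun_prop)).inter (isOpen_lt (by fun_prop) (by fun_prop)))

/-- The values of `Λ` in the coordinates `(s, q)`, where `s = |v|` and `q` is proportional
to `v₂²`. -/
lemma Lam_coords {v : EuclideanSpace ℝ (Fin 2)} {q : ℝ} (hv : ‖v‖ ∈ Ioo π vartheta1)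
    (hq : q ∈ Ioo 0 1) (hz : v 1 ^ 2 * tpoly ‖v‖ = 2 * q * ‖v‖ ^ 2 * beta ‖v‖)
    (h0 : 0 < v 0) (h1 : v 1 < 0) :
    0 < Lam v 0 ∧ 0 < Lam v 1 ∧ psi0 (‖v‖ ^ 2) + v 1 ^ 2 * psi1 (‖v‖ ^ 2) < 0 ∧
      levelRatio ‖v‖ q = Lam v 1 ^ 4 / (16 * Lam v 0 ^ 2) ∧ levelSq ‖v‖ q = Lam v 0 ^ 2 / 4 := by
  have hb := beta_pos hv
  have ht := one_pos.trans_le (one_le_tpoly (Ioo_subset_Ico_self hv))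
  have hr := one_pos.trans_le (one_le_rpoly (Ioo_subset_Ico_self hv) hq.2.le)
  have hs := pi_pos.trans hv.1
  have hq0 := hq.1
  have hq1 : 0 < 1 - q := sub_pos.2 hq.2
  have hN := norm_sq_two v
  have hrt : rpoly ‖v‖ q = tpoly ‖v‖ - 2 * q * beta ‖v‖ := by
    rw [rpoly, tpoly]
    ring
  have hp : v 0 ^ 2 * tpoly ‖v‖ = ‖v‖ ^ 2 * rpoly ‖v‖ q := by
    rw [hrt]
    linear_combination (-tpoly ‖v‖) * hN - hz
  have e1 : v 1 ^ 2 * psi1 (‖v‖ ^ 2) = q / (‖v‖ ^ 2 * beta ‖v‖) := by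
    rw [psi1_sq hv, ← tpoly]
    field_simp
    linear_combination hz
  have e2 : psi0 (‖v‖ ^ 2) + v 1 ^ 2 * psi1 (‖v‖ ^ 2) = -(1 - q) / (‖v‖ ^ 2 * beta ‖v‖) := by
    rw [e1, psi0_sq hv]
    field_simp
    ring
  have e3 : Lam v 0 = 2 * q * v 0 / (‖v‖ ^ 2 * beta ‖v‖) := by
    rw [Lam_zero hv]
    linear_combination 2 * v 0 * e1
  have e4 : Lam v 1 = 2 * (-v 1) * (1 - q) / (‖v‖ ^ 2 * beta ‖v‖) := by
    rw [Lam_one hv, e2]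
    ring
  have h1' : 0 < -v 1 := neg_pos.2 h1
  have hz' : v 1 ^ 2 = 2 * q * ‖v‖ ^ 2 * beta ‖v‖ / tpoly ‖v‖ := by
    rw [eq_div_iff ht.ne', hz]
  have hp' : v 0 ^ 2 = ‖v‖ ^ 2 * rpoly ‖v‖ q / tpoly ‖v‖ := by
    rw [eq_div_iff ht.ne', hp]
  have e5 : Lam v 0 ^ 2 = 4 * q ^ 2 * v 0 ^ 2 / (‖v‖ ^ 2 * beta ‖v‖) ^ 2 := by
    rw [e3]
    ring
  have e6 : Lam v 1 ^ 4 = 16 * (v 1 ^ 2) ^ 2 * (1 - q) ^ 4 / (‖v‖ ^ 2 * beta ‖v‖) ^ 4 := by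
    rw [e4]
    ring
  refine ⟨by rw [e3]; positivity, by rw [e4]; positivity, ?_, ?_, ?_⟩
  · rw [e2]
    exact div_neg_of_neg_of_pos (by linarith) (by positivity)
  · rw [e5, e6, hz', hp', levelRatio]
    field_simp
    ring
  · rw [e5, hp', levelSq]
    field_simp

lemma exists_coord {v : EuclideanSpace ℝ (Fin 2)} (hv : v ∈ OmegaMinusFour) :
    ∃ q ∈ Ioo (0 : ℝ) 1, v 1 ^ 2 * tpoly ‖v‖ = 2 * q * ‖v‖ ^ 2 * beta ‖v‖ := by
  obtain ⟨hs, h1, h0, hK⟩ := mem_OmegaMinusFour_iff.1 hv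
  have hb := beta_pos hs
  have ht := one_pos.trans_le (one_le_tpoly (Ioo_subset_Ico_self hs))
  have hs0 := pi_pos.trans hs.1
  have h2 : 0 < v 1 ^ 2 := by nlinarith
  refine ⟨v 1 ^ 2 * tpoly ‖v‖ / (2 * ‖v‖ ^ 2 * beta ‖v‖), ⟨by positivity, ?_⟩, by field_simp⟩
  rw [psi0_sq hs, psi1_sq hs, ← tpoly] at hK
  have e : -1 / (‖v‖ ^ 2 * beta ‖v‖) + v 1 ^ 2 * (tpoly ‖v‖ / (2 * (‖v‖ ^ 2) ^ 2 * beta ‖v‖ ^ 2)) =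
      (v 1 ^ 2 * tpoly ‖v‖ / (2 * ‖v‖ ^ 2 * beta ‖v‖) - 1) / (‖v‖ ^ 2 * beta ‖v‖) := by
    field_simp
    ring
  rw [e, div_neg_iff] at hK
  rcases hK with h | h
  · have : 0 < ‖v‖ ^ 2 * beta ‖v‖ := by positivity
    linarith [h.2]
  · linarith [h.1]

lemma injOn_Lam : InjOn Lam OmegaMinusFour := by
  intro v hv v' hv' h
  obtain ⟨q, hq, hz⟩ := exists_coord hv
  obtain ⟨q', hq', hz'⟩ := exists_coord hv'
  obtain ⟨hs, h1, h0, hK⟩ := mem_OmegaMinusFour_iff.1 hv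
  obtain ⟨hs', h1', h0', hK'⟩ := mem_OmegaMinusFour_iff.1 hv'
  obtain ⟨-, -, -, ha, hb⟩ := Lam_coords hs hq hz (pi_pos.trans h0) h1
  obtain ⟨-, -, -, ha', hb'⟩ := Lam_coords hs' hq' hz' (pi_pos.trans h0') h1'
  obtain ⟨e1, e2⟩ := level_unique hs hs' hq hq' (by rw [ha, ha', h]) (by rw [hb, hb', h])
  have ht := one_pos.trans_le (one_le_tpoly (Ioo_subset_Ico_self hs'))
  have e3 : v 1 ^ 2 = v' 1 ^ 2 := by
    rw [e1, e2, ← hz'] at hz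
    exact mul_right_cancel₀ ht.ne' hz
  have e4 : v 0 ^ 2 = v' 0 ^ 2 := by
    have n1 := norm_sq_two v
    have n2 := norm_sq_two v'
    rw [e1] at n1
    linarith
  have e5 : v 1 = v' 1 := by nlinarith
  have e6 : v 0 = v' 0 :=
    (pow_left_inj₀ (pi_pos.trans h0).le (pi_pos.trans h0').le two_ne_zero).1 e4
  ext i
  fin_cases i
  · exact e6
  · exact e5

lemma mem_R2LtPos_iff {u : EuclideanSpace ℝ (Fin 2)} :
    u ∈ R2LtPos ↔ 0 < u 0 ∧ 0 < u 1 ∧ u 1 ^ 4 / (16 * u 0 ^ 2) < 1 / π ^ 2 := by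
  have hpi := pi_pos
  refine and_congr_right fun h0 => and_congr_right fun h1 => ?_
  have e : (2 / √π * √(u 0)) ^ 4 = 16 * u 0 ^ 2 / π ^ 2 := by
    have e1 : √π ^ 4 = π ^ 2 := by
      rw [show √π ^ 4 = (√π ^ 2) ^ 2 by ring, sq_sqrt hpi.le]
    have e2 : √(u 0) ^ 4 = u 0 ^ 2 := by
      rw [show √(u 0) ^ 4 = (√(u 0) ^ 2) ^ 2 by ring, sq_sqrt h0.le]
    rw [mul_pow, div_pow, e1, e2]
    ring
  rw [← pow_lt_pow_iff_left₀ h1.le (by positivity) (four_ne_zero), e, div_lt_div_iff₀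
    (by positivity) (by positivity), lt_div_iff₀ (by positivity), one_mul]

lemma mapsTo_Lam : MapsTo Lam OmegaMinusFour R2LtPos := by
  intro v hv
  obtain ⟨q, hq, hz⟩ := exists_coord hv
  obtain ⟨hs, h1, h0, hK⟩ := mem_OmegaMinusFour_iff.1 hv
  obtain ⟨l0, l1, -, ha, hb⟩ := Lam_coords hs hq hz (pi_pos.trans h0) h1
  have hpi := pi_pos
  have hle : π ∈ Ico π vartheta1 := ⟨le_rfl, vartheta1_mem.1⟩
  refine mem_R2LtPos_iff.2 ⟨l0, l1, ?_⟩
  rw [← ha]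
  calc levelRatio ‖v‖ q < levelRatio π q :=
        levelRatio_lt_of_lt hle (Ioo_subset_Ico_self hs) hs.1 hq.2
    _ < levelRatio π 0 :=
        levelRatio_strictAntiOn hle (by simp) (Ioo_subset_Icc_self hq) hq.1
    _ = 1 / π ^ 2 := by simp [levelRatio, tpoly_pi, rpoly_pi]

lemma surjOn_Lam : SurjOn Lam OmegaMinusFour R2LtPos := by
  intro u hu
  obtain ⟨h0, h1, h2⟩ := mem_R2LtPos_iff.1 hu
  obtain ⟨s, hs, q, hq, hr, hl⟩ := level_exists (by positivity) h2
    (show 0 < u 0 ^ 2 / 4 by positivity)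
  have hb := beta_pos hs
  have ht := one_pos.trans_le (one_le_tpoly (Ioo_subset_Ico_self hs))
  have hs0 := pi_pos.trans hs.1
  have hq0 := hq.1
  -- The value of `v 1 ^ 2` prescribed by q; `v 0 ^ 2` is then `s ^ 2 - z`.
  set z := 2 * q * s ^ 2 * beta s / tpoly s with hzdef
  have hz : z * tpoly s = 2 * q * s ^ 2 * beta s := div_mul_cancel₀ _ ht.ne'
  have hz0 : 0 < z := by positivity
  have hp : π ^ 2 < s ^ 2 - z := by
    have h3 := pi_sq_mul_tpoly_lt hs
    have h4 : 2 * q * s ^ 2 * beta s < 2 * s ^ 2 * beta s := by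
      have : 0 < 2 * s ^ 2 * beta s := by positivity
      nlinarith [hq.2]
    by_contra! h5
    nlinarith [mul_le_mul_of_nonneg_right h5 ht.le]
  have hpn : 0 ≤ s ^ 2 - z := (sq_nonneg π).trans hp.le
  let v : EuclideanSpace ℝ (Fin 2) := !₂[√(s ^ 2 - z), -√z]
  have v0 : v 0 = √(s ^ 2 - z) := rfl
  have v1 : v 1 = -√z := rfl
  have hn : ‖v‖ = s := by
    rw [← pow_left_inj₀ (norm_nonneg v) hs0.le two_ne_zero, norm_sq_two, v0, v1, neg_sq,
      sq_sqrt hpn, sq_sqrt hz0.le]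
    ring
  have hv0 : π < v 0 := by
    rw [v0]
    exact lt_sqrt_of_sq_lt hp
  have hv1 : v 1 < 0 := by
    rw [v1]
    exact neg_neg_of_pos (sqrt_pos.2 hz0)
  have hvn : ‖v‖ ∈ Ioo π vartheta1 := by rwa [hn]
  obtain ⟨l0, l1, hK, ha, hb⟩ := Lam_coords (q := q) hvn hq
    (by rw [hn, v1, neg_sq, sq_sqrt hz0.le, hz]) (pi_pos.trans hv0) hv1
  refine ⟨v, mem_OmegaMinusFour_iff.2 ⟨hvn, hv1, hv0, hK⟩, ?_⟩
  rw [hn, hr] at ha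
  rw [hn, hl] at hb
  have e0 : Lam v 0 = u 0 := (pow_left_inj₀ l0.le h0.le two_ne_zero).1 (by linarith)
  rw [e0, div_left_inj' (by positivity)] at ha
  have e1 : Lam v 1 = u 1 := (pow_left_inj₀ l1.le h1.le four_ne_zero).1 ha.symm
  ext i
  fin_cases i
  · exact e0
  · exact e1

/-! ### Sign of the Jacobian determinant of Λ -/

/-- With s cot s = 1 + b, b = 1/β > 0 and w = s² > 1, each claim reduces to an expression with
visibly positive terms. The last two express that 1/ψ is strictly concave and w² ψ strictly
increasing as functions of w. -/
lemma psi0_psi1_psi2_ineq {s : ℝ} (hs : s ∈ Ioo π vartheta1) :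
    psi0 (s ^ 2) < 0 ∧ 0 < psi1 (s ^ 2) ∧ psi2 (s ^ 2) < 0 ∧
      psi0 (s ^ 2) * psi2 (s ^ 2) < 2 * psi1 (s ^ 2) ^ 2 ∧
      -2 * psi0 (s ^ 2) < s ^ 2 * psi1 (s ^ 2) := by
  have hw : 1 < s ^ 2 := one_lt_pow₀ (by linarith [hs.1, pi_gt_three]) two_ne_zero
  have hb : 0 < 1 / beta s := one_div_pos.2 (beta_pos hs)
  have ha := cotw_sq hs
  unfold psi0 psi1 psi2
  generalize s ^ 2 = w at *
  rw [ha]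
  generalize 1 / beta s = b at *
  have hw0 : 0 < w := by linarith
  refine ⟨?_, ?_, ?_, ?_, ?_⟩
  · exact div_neg_of_neg_of_pos (by linarith) hw0
  · refine div_pos ?_ (by positivity)
    have : 0 < b ^ 2 + 3 * b + w := by positivity
    linarith
  · refine div_neg_of_neg_of_pos ?_ (by positivity)
    have : 0 < b * (2 * (1 + b) ^ 2 + 5 * (1 + b) + 8) + (2 * (1 + b) + 3) * w := by positivity
    linarith
  · rw [← sub_pos]
    have : 0 < (3 * (1 + b) * b ^ 2 + b * (2 * (1 + b) + 5) * w + 2 * w ^ 2) / (4 * w ^ 4) := by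
      positivity
    convert this using 1
    field_simp
    ring
  · rw [← sub_pos]
    have : 0 < ((b - 1 / 2) ^ 2 + (w - 1 / 4)) / (2 * w) := by
      have : 0 < w - 1 / 4 := by linarith
      positivity
    convert this using 1
    field_simp
    ring

/-- Up to the factor 4z, the determinant is affine in z = `v 1 ^ 2` once w = ‖v‖² is fixed. With a,
b for `psi0`, `psi1`, the condition a + zb < 0 confines z to (0, -a/b), so the signs at the two
endpoints decide. -/
lemma hess_det_neg {v : EuclideanSpace ℝ (Fin 2)} (hv : v ∈ OmegaMinusFour) :
    2 * v 1 ^ 2 * (psi1 (‖v‖ ^ 2) + 2 * v 0 ^ 2 * psi2 (‖v‖ ^ 2)) *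
        (2 * psi0 (‖v‖ ^ 2) + 10 * v 1 ^ 2 * psi1 (‖v‖ ^ 2) + 4 * v 1 ^ 4 * psi2 (‖v‖ ^ 2)) -
      (4 * v 0 * v 1 * (psi1 (‖v‖ ^ 2) + v 1 ^ 2 * psi2 (‖v‖ ^ 2))) ^ 2 < 0 := by
  obtain ⟨hs, h1, h0, hK⟩ := mem_OmegaMinusFour_iff.1 hv
  obtain ⟨i0, i1, i2, i3, i4⟩ := psi0_psi1_psi2_ineq hs
  have hN := norm_sq_two v
  have hz : 0 < v 1 ^ 2 := by nlinarith
  have hP : v 0 ^ 2 = ‖v‖ ^ 2 - v 1 ^ 2 := by linarith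
  have hw : 0 < ‖v‖ ^ 2 := by nlinarith
  generalize ‖v‖ ^ 2 = w at *
  generalize psi0 w = a at *
  generalize psi1 w = b at *
  generalize psi2 w = d at *
  have e : 2 * v 1 ^ 2 * (b + 2 * v 0 ^ 2 * d) *
        (2 * a + 10 * v 1 ^ 2 * b + 4 * v 1 ^ 4 * d) -
      (4 * v 0 * v 1 * (b + v 1 ^ 2 * d)) ^ 2 =
      4 * v 1 ^ 2 * (a * b + 2 * w * (a * d - 2 * b ^ 2) +
        v 1 ^ 2 * (9 * b ^ 2 + 2 * w * b * d - 2 * a * d)) := by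
    rw [mul_pow, mul_pow, mul_pow, hP]
    ring
  rw [e]
  generalize v 1 ^ 2 = z at *
  -- The value of the affine function at z = 0.
  have j0 : a * b + 2 * w * (a * d - 2 * b ^ 2) < 0 := by
    have := mul_pos (neg_pos.2 i0) i1
    have := mul_pos hw (sub_pos.2 i3)
    linarith
  -- b times its value at z = -a/b.
  have j1 : -8 * a * b ^ 2 - 4 * w * b ^ 3 + 2 * a ^ 2 * d < 0 := by
    have h1 : 0 < b ^ 2 * (w * b - -2 * a) := mul_pos (by positivity) (sub_pos.2 i4)
    have h2 : 0 ≤ a ^ 2 * (-d) := mul_nonneg (sq_nonneg a) (by linarith)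
    linarith
  -- Interpolation between the endpoints, with weights -(a + zb) and z.
  have j2 : 0 < (-a) * -(a * b + 2 * w * (a * d - 2 * b ^ 2) +
        z * (9 * b ^ 2 + 2 * w * b * d - 2 * a * d)) := by
    have k1 := mul_pos (neg_pos.2 hK) (neg_pos.2 j0)
    have k2 := mul_pos hz (neg_pos.2 j1)
    linarith
  have j3 := (pos_iff_pos_of_mul_pos j2).1 (neg_pos.2 i0)
  exact mul_neg_of_pos_of_neg (by positivity) (neg_pos.1 j3)

/-! ### Differentiability of Λ and the inverse function theorem -/

variable {n : ℕ}

lemma hasFDerivAt_coord (i : Fin n) (v : EuclideanSpace ℝ (Fin n)) :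
    HasFDerivAt (fun v : EuclideanSpace ℝ (Fin n) => v i)
      (EuclideanSpace.proj i : EuclideanSpace ℝ (Fin n) →L[ℝ] ℝ) v :=
  (EuclideanSpace.proj i : EuclideanSpace ℝ (Fin n) →L[ℝ] ℝ).hasFDerivAt

lemma hasFDerivAt_comp_norm_sq {g : ℝ → ℝ} {g' : ℝ} {v : EuclideanSpace ℝ (Fin n)}
    (hg : HasDerivAt g g' (‖v‖ ^ 2)) :
    HasFDerivAt (fun v : EuclideanSpace ℝ (Fin n) => g (‖v‖ ^ 2))
      (g' • 2 • innerSL ℝ v) v :=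
  HasDerivAt.comp_hasFDerivAt (f := fun v : EuclideanSpace ℝ (Fin n) => ‖v‖ ^ 2) v hg
    (hasStrictFDerivAt_norm_sq v).hasFDerivAt

lemma contDiffAt_comp_norm_sq {g : ℝ → ℝ} {v : EuclideanSpace ℝ (Fin n)}
    (hg : ContDiffAt ℝ ∞ g (‖v‖ ^ 2)) :
    ContDiffAt ℝ ∞ (fun v : EuclideanSpace ℝ (Fin n) => g (‖v‖ ^ 2)) v :=
  ContDiffAt.comp (f := fun v : EuclideanSpace ℝ (Fin n) => ‖v‖ ^ 2) v hg
    (contDiff_norm_sq ℝ).contDiffAt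

lemma contDiffAt_coord (i : Fin n) (v : EuclideanSpace ℝ (Fin n)) :
    ContDiffAt ℝ ∞ (fun v : EuclideanSpace ℝ (Fin n) => v i) v :=
  (EuclideanSpace.proj i : EuclideanSpace ℝ (Fin n) →L[ℝ] ℝ).contDiff.contDiffAt

lemma eventually_norm_mem_Ioo {v : EuclideanSpace ℝ (Fin n)} (hv : ‖v‖ ∈ Ioo π vartheta1) :
    ∀ᶠ v' : EuclideanSpace ℝ (Fin n) in nhds v, ‖v'‖ ∈ Ioo π vartheta1 :=
  (isOpen_Ioo.preimage continuous_norm).mem_nhds hv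

lemma contDiffAt_Lam {v : EuclideanSpace ℝ (Fin 2)} (hv : ‖v‖ ∈ Ioo π vartheta1) :
    ContDiffAt ℝ ∞ Lam v := by
  have hw := sq_mem_regularSet hv
  have h0 := contDiffAt_coord 0 v
  have h1 := contDiffAt_coord 1 v
  have p0 := contDiffAt_comp_norm_sq (contDiffAt_psi0 hw)
  have p1 := contDiffAt_comp_norm_sq (contDiffAt_psi1 hw)
  have hev := eventually_norm_mem_Ioo hv
  rw [contDiffAt_euclidean]
  intro i
  fin_cases i
  · refine (((contDiffAt_const (c := (2 : ℝ))).mul p1).mul (h1.pow 2)).mul h0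
      |>.congr_of_eventuallyEq ?_
    filter_upwards [hev] with v hv using Lam_zero hv
  · refine ((contDiffAt_const (c := (2 : ℝ))).mul h1).mul (p0.add ((h1.pow 2).mul p1))
      |>.congr_of_eventuallyEq ?_
    filter_upwards [hev] with v hv using Lam_one hv

lemma fderiv_Lam_apply {v : EuclideanSpace ℝ (Fin 2)} (hv : ‖v‖ ∈ Ioo π vartheta1)
    (h : EuclideanSpace ℝ (Fin 2)) :
    fderiv ℝ Lam v h 0 = 2 * v 1 ^ 2 * (psi1 (‖v‖ ^ 2) + 2 * v 0 ^ 2 * psi2 (‖v‖ ^ 2)) * h 0 +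
        4 * v 0 * v 1 * (psi1 (‖v‖ ^ 2) + v 1 ^ 2 * psi2 (‖v‖ ^ 2)) * h 1 ∧
      fderiv ℝ Lam v h 1 = 4 * v 0 * v 1 * (psi1 (‖v‖ ^ 2) + v 1 ^ 2 * psi2 (‖v‖ ^ 2)) * h 0 +
        (2 * psi0 (‖v‖ ^ 2) + 10 * v 1 ^ 2 * psi1 (‖v‖ ^ 2) + 4 * v 1 ^ 4 * psi2 (‖v‖ ^ 2)) *
          h 1 := by
  have hw := sq_mem_regularSet hv
  have h0 := hasFDerivAt_coord 0 v
  have h1 := hasFDerivAt_coord 1 v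
  have p0 := hasFDerivAt_comp_norm_sq (hasDerivAt_psi0 hw)
  have p1 := hasFDerivAt_comp_norm_sq (hasDerivAt_psi1 hw)
  have hev := eventually_norm_mem_Ioo hv
  have hd : HasFDerivAt Lam (fderiv ℝ Lam v) v :=
    ((contDiffAt_Lam hv).differentiableAt (by simp)).hasFDerivAt
  have hc : ∀ i, HasFDerivAt (fun v => Lam v i) ((EuclideanSpace.proj i :
      EuclideanSpace ℝ (Fin 2) →L[ℝ] ℝ).comp (fderiv ℝ Lam v)) v := fun i =>
    (hasFDerivAt_coord i (Lam v)).comp v hd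
  constructor
  · have e := ((p1.const_mul 2).mul (h1.pow 2)).mul h0 |>.congr_of_eventuallyEq
      (f₁ := fun v => Lam v 0) (by filter_upwards [hev] with v hv using Lam_zero hv)
    have := DFunLike.congr_fun ((hc 0).unique e) h
    simp [PiLp.inner_apply, Fin.sum_univ_two] at this
    rw [this]
    ring
  · have e := (h1.const_mul 2).mul (p0.add ((h1.pow 2).mul p1)) |>.congr_of_eventuallyEq
      (f₁ := fun v => Lam v 1) (by filter_upwards [hev] with v hv using Lam_one hv)
    have := DFunLike.congr_fun ((hc 1).unique e) h
    simp [PiLp.inner_apply, Fin.sum_univ_two] at this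
    rw [this]
    ring

lemma exists_equiv_fderiv_Lam {v : EuclideanSpace ℝ (Fin 2)} (hv : v ∈ OmegaMinusFour) :
    ∃ e : EuclideanSpace ℝ (Fin 2) ≃L[ℝ] EuclideanSpace ℝ (Fin 2),
      HasFDerivAt Lam (e : EuclideanSpace ℝ (Fin 2) →L[ℝ] EuclideanSpace ℝ (Fin 2)) v := by
  have hs := (mem_OmegaMinusFour_iff.1 hv).1
  have hd : HasFDerivAt Lam (fderiv ℝ Lam v) v :=
    ((contDiffAt_Lam hs).differentiableAt (by simp)).hasFDerivAt
  have hinj : Function.Injective (fderiv ℝ Lam v).toLinearMap := by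
    rw [← LinearMap.ker_eq_bot, LinearMap.ker_eq_bot']
    intro h hh
    obtain ⟨e0, e1⟩ := fderiv_Lam_apply hs h
    have hdet := (hess_det_neg hv).ne
    rw [show fderiv ℝ Lam v h = 0 from hh] at e0 e1
    simp only [PiLp.zero_apply] at e0 e1
    generalize 2 * v 1 ^ 2 * (psi1 (‖v‖ ^ 2) + 2 * v 0 ^ 2 * psi2 (‖v‖ ^ 2)) = A at *
    generalize 4 * v 0 * v 1 * (psi1 (‖v‖ ^ 2) + v 1 ^ 2 * psi2 (‖v‖ ^ 2)) = B at *
    generalize 2 * psi0 (‖v‖ ^ 2) + 10 * v 1 ^ 2 * psi1 (‖v‖ ^ 2) +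
      4 * v 1 ^ 4 * psi2 (‖v‖ ^ 2) = C at *
    -- Cramer's rule for the symmetric matrix with entries A, B, C.
    have k0 : (A * C - B ^ 2) * h 0 = 0 := by linear_combination B * e1 - C * e0
    have k1 : (A * C - B ^ 2) * h 1 = 0 := by linear_combination B * e0 - A * e1
    ext i
    fin_cases i
    · exact (mul_eq_zero.1 k0).resolve_left hdet
    · exact (mul_eq_zero.1 k1).resolve_left hdet
  exact ⟨(LinearEquiv.ofInjectiveEndo _ hinj).toContinuousLinearEquiv, hd⟩

theorem isSmoothDiffeoOn_Lam :
    IsSmoothDiffeoOn Lam (Function.invFunOn Lam OmegaMinusFour) OmegaMinusFour R2LtPos := by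
  have hinv : InvOn (Function.invFunOn Lam OmegaMinusFour) Lam OmegaMinusFour R2LtPos :=
    ⟨injOn_Lam.leftInvOn_invFunOn, surjOn_Lam.rightInvOn_invFunOn⟩
  refine ⟨isOpen_OmegaMinusFour, isOpen_R2LtPos, ⟨mapsTo_Lam, injOn_Lam, surjOn_Lam⟩, hinv,
    fun v hv => (contDiffAt_Lam (mem_OmegaMinusFour_iff.1 hv).1).contDiffWithinAt, ?_⟩
  intro u hu
  obtain ⟨v, hv, rfl⟩ := surjOn_Lam hu
  obtain ⟨e, he⟩ := exists_equiv_fderiv_Lam hv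
  have hc := contDiffAt_Lam (mem_OmegaMinusFour_iff.1 hv).1
  have hl := hc.to_localInverse he (by simp)
  -- Near `Lam v` the local inverse takes values in the open region on which Λ is injective, so it
  -- coincides there with the global inverse.
  refine (hl.congr_of_eventuallyEq ?_).contDiffWithinAt
  have h1 : ∀ᶠ u in nhds (Lam v), Lam (hc.localInverse he (by simp) u) = u :=
    (hc.hasStrictFDerivAt' he (by simp)).eventually_right_inverse
  have h2 : ∀ᶠ u in nhds (Lam v), hc.localInverse he (by simp) u ∈ OmegaMinusFour :=
    hl.continuousAt.eventually_mem (isOpen_OmegaMinusFour.mem_nhds (by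
      rwa [hc.localInverse_apply_image he (by simp)]))
  filter_upwards [h1, h2] with u hu1 hu2
  conv_lhs => rw [← hu1]
  exact hinv.1 hu2

/-! ### The functional calculus of U(τ) and a closed form of φ -/

lemma norm_sq_three (τ : EuclideanSpace ℝ (Fin 3)) :
    ‖τ‖ ^ 2 = τ 0 ^ 2 + τ 1 ^ 2 + τ 2 ^ 2 := by
  rw [EuclideanSpace.real_norm_sq_eq, Fin.sum_univ_three]

lemma norm_embed (v : EuclideanSpace ℝ (Fin 2)) : ‖embed v‖ = ‖v‖ := by
  rw [← pow_left_inj₀ (norm_nonneg _) (norm_nonneg _) two_ne_zero, norm_sq_three, norm_sq_two]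
  simp [embed]

lemma isSelfAdjoint_U (τ : EuclideanSpace ℝ (Fin 3)) : IsSelfAdjoint (U τ) := by
  rw [IsSelfAdjoint, Matrix.star_eq_conjTranspose]
  ext i j
  fin_cases i <;> fin_cases j <;> simp [U]

/-- Cayley–Hamilton: the eigenvalues are 0 and ±|τ|. -/
lemma U_pow_three (τ : EuclideanSpace ℝ (Fin 3)) : U τ ^ 3 = (‖τ‖ ^ 2) • U τ := by
  have h := norm_sq_three τ
  rw [h, pow_succ, pow_two]
  ext i j
  fin_cases i <;> fin_cases j <;>
    simp [U, Matrix.mul_apply, Fin.sum_univ_three] <;> ring_nf <;> simp <;> ring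

lemma spectrum_U_subset {τ : EuclideanSpace ℝ (Fin 3)} {x : ℝ} (hx : x ∈ spectrum ℝ (U τ)) :
    x = 0 ∨ x ^ 2 = ‖τ‖ ^ 2 := by
  have hU := isSelfAdjoint_U τ
  have h : cfc (fun x : ℝ => x ^ 3) (U τ) = cfc (fun x : ℝ => ‖τ‖ ^ 2 * x) (U τ) := by
    rw [cfc_pow_id (U τ) 3, cfc_const_mul_id (‖τ‖ ^ 2) (U τ), U_pow_three]
  have h1 := (cfc_eq_cfc_iff_eqOn (R := ℝ) (a := U τ)).1 h hx
  have h2 : x * (x ^ 2 - ‖τ‖ ^ 2) = 0 := by linear_combination h1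
  rcases mul_eq_zero.1 h2 with h3 | h3
  · exact Or.inl h3
  · exact Or.inr (sub_eq_zero.1 h3)

/-- The even function s cot s agrees on {0, ±|τ|} with the quadratic 1 - ψ(|τ|) s², which
interpolates it. -/
lemma cfc_sCot_U {τ : EuclideanSpace ℝ (Fin 3)} (hτ : 0 < ‖τ‖) :
    cfc sCot (U τ) = 1 - psi ‖τ‖ • U τ ^ 2 := by
  have hU := isSelfAdjoint_U τ
  have h : (spectrum ℝ (U τ)).EqOn sCot (fun x => 1 - psi ‖τ‖ * x ^ 2) := by
    intro x hx
    by_cases h0 : x = 0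
    · simp [sCot, h0]
    · have h1 := (spectrum_U_subset hx).resolve_left h0
      have h2 : x * cot x = ‖τ‖ * cot ‖τ‖ := by
        rcases sq_eq_sq_iff_eq_or_eq_neg.1 h1 with h | h
        · rw [h]
        · rw [h, cot_eq_cos_div_sin, cot_eq_cos_div_sin, cos_neg, sin_neg, div_neg]
          ring
      simp only [sCot, if_neg h0, h1, h2, psi]
      field_simp
      ring
  rw [cfc_congr h, cfc_sub (fun _ => 1) (fun x => psi ‖τ‖ * x ^ 2) (U τ), cfc_const_one ℝ (U τ),
    cfc_const_mul (psi ‖τ‖) (fun x => x ^ 2) (U τ), cfc_pow_id (U τ) 2]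

lemma phi_eq {τ : EuclideanSpace ℝ (Fin 3)} (hτ : 0 < ‖τ‖) (c : ℝ)
    (t : EuclideanSpace ℝ (Fin 3)) :
    phi (c • EuclideanSpace.single 0 1) t τ =
      c ^ 2 * (1 - psi0 (‖τ‖ ^ 2) * (τ 1 ^ 2 + τ 2 ^ 2)) + 4 * inner ℝ t τ := by
  rw [phi, cfc_sCot_U hτ, psi_eq hτ.le]
  congr 1
  simp [dotProduct, Matrix.mulVec, Fin.sum_univ_three, U, pow_two, Matrix.mul_apply]
  ring

/-! ### The Hessian of φ and its signature -/

lemma hessian_eq {n : ℕ} {f : EuclideanSpace ℝ (Fin n) → ℝ} {p : EuclideanSpace ℝ (Fin n)}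
    {G : Fin n → EuclideanSpace ℝ (Fin n) → ℝ} {L : Fin n → EuclideanSpace ℝ (Fin n) →L[ℝ] ℝ}
    (hf : ∀ᶠ τ in nhds p, HasFDerivAt f
      (∑ j, G j τ • (EuclideanSpace.proj j : EuclideanSpace ℝ (Fin n) →L[ℝ] ℝ)) τ)
    (hG : ∀ j, HasFDerivAt (G j) (L j) p) :
    hessian f p = Matrix.of fun i j => L j (EuclideanSpace.single i 1) := by
  have h1 : HasFDerivAt (fderiv ℝ f) (∑ j, (L j).smulRight
      (EuclideanSpace.proj j : EuclideanSpace ℝ (Fin n) →L[ℝ] ℝ)) p := by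
    have h2 := HasFDerivAt.fun_sum (u := Finset.univ) fun j _ => (hG j).smul_const
      (EuclideanSpace.proj j : EuclideanSpace ℝ (Fin n) →L[ℝ] ℝ)
    refine h2.congr_of_eventuallyEq ?_
    filter_upwards [hf] with τ hτ using hτ.fderiv
  ext i j
  simp [hessian, h1.fderiv]

lemma phi_eventuallyEq {p : EuclideanSpace ℝ (Fin 3)} (hp : ‖p‖ ∈ Ioo π vartheta1) (c : ℝ)
    (t : EuclideanSpace ℝ (Fin 3)) :
    phi (c • EuclideanSpace.single 0 1) t =ᶠ[nhds p] fun τ =>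
      c ^ 2 * (1 - psi0 (‖τ‖ ^ 2) * (τ 1 ^ 2 + τ 2 ^ 2)) + 4 * inner ℝ t τ := by
  filter_upwards [eventually_norm_mem_Ioo hp] with τ hτ using phi_eq (pi_pos.trans hτ.1) c t

lemma contDiffAt_phi {p : EuclideanSpace ℝ (Fin 3)} (hp : ‖p‖ ∈ Ioo π vartheta1) (c : ℝ)
    (t : EuclideanSpace ℝ (Fin 3)) :
    ContDiffAt ℝ ∞ (phi (c • EuclideanSpace.single 0 1) t) p := by
  have p0 := contDiffAt_comp_norm_sq (contDiffAt_psi0 (sq_mem_regularSet hp))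
  refine ContDiffAt.congr_of_eventuallyEq ?_ (phi_eventuallyEq hp c t)
  exact (contDiffAt_const.mul (contDiffAt_const.sub (p0.mul
    (((contDiffAt_coord 1 p).pow 2).add ((contDiffAt_coord 2 p).pow 2))))).add
    (contDiffAt_const.mul (contDiffAt_const.inner ℝ contDiffAt_id))

/-- The partial derivatives of `phi`. -/
noncomputable def gradPhi (c : ℝ) (t : EuclideanSpace ℝ (Fin 3)) (j : Fin 3)
    (τ : EuclideanSpace ℝ (Fin 3)) : ℝ :=
  -(2 * c ^ 2) * ((psi1 (‖τ‖ ^ 2) * (τ 1 ^ 2 + τ 2 ^ 2) +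
    (if j = 0 then 0 else 1) * psi0 (‖τ‖ ^ 2)) * τ j) + 4 * t j

lemma hasFDerivAt_phi {p : EuclideanSpace ℝ (Fin 3)} (hp : ‖p‖ ∈ Ioo π vartheta1) (c : ℝ)
    (t : EuclideanSpace ℝ (Fin 3)) :
    HasFDerivAt (phi (c • EuclideanSpace.single 0 1) t) (∑ j, gradPhi c t j p •
      (EuclideanSpace.proj j : EuclideanSpace ℝ (Fin 3) →L[ℝ] ℝ)) p := by
  have p0 := hasFDerivAt_comp_norm_sq (hasDerivAt_psi0 (sq_mem_regularSet hp))
  refine HasFDerivAt.congr_of_eventuallyEq ?_ (phi_eventuallyEq hp c t)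
  refine ((((p0.mul (((hasFDerivAt_coord 1 p).pow 2).add
    ((hasFDerivAt_coord 2 p).pow 2))).const_sub 1).const_mul (c ^ 2)).add
    ((innerSL ℝ t).hasFDerivAt.const_mul 4)).congr_fderiv ?_
  ext h
  simp [gradPhi, PiLp.inner_apply, Fin.sum_univ_three]
  ring

/-- The upper block is the Jacobian matrix of Λ and the last entry is K₃. The mixed entries vanish
because φ is even in `τ 2` up to a linear term. -/
lemma hessian_phi {v : EuclideanSpace ℝ (Fin 2)} (hv : ‖v‖ ∈ Ioo π vartheta1) (c : ℝ)
    (t : EuclideanSpace ℝ (Fin 3)) :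
    hessian (phi (c • EuclideanSpace.single 0 1) t) (embed v) = (-c ^ 2) • !![
      2 * v 1 ^ 2 * (psi1 (‖v‖ ^ 2) + 2 * v 0 ^ 2 * psi2 (‖v‖ ^ 2)),
      4 * v 0 * v 1 * (psi1 (‖v‖ ^ 2) + v 1 ^ 2 * psi2 (‖v‖ ^ 2)), 0;
      4 * v 0 * v 1 * (psi1 (‖v‖ ^ 2) + v 1 ^ 2 * psi2 (‖v‖ ^ 2)),
      2 * psi0 (‖v‖ ^ 2) + 10 * v 1 ^ 2 * psi1 (‖v‖ ^ 2) + 4 * v 1 ^ 4 * psi2 (‖v‖ ^ 2), 0;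
      0, 0, 2 * (psi0 (‖v‖ ^ 2) + v 1 ^ 2 * psi1 (‖v‖ ^ 2))] := by
  have e0 : embed v 0 = v 0 := rfl
  have e1 : embed v 1 = v 1 := rfl
  have e2 : embed v 2 = 0 := rfl
  have hn := norm_embed v
  have hp : ‖embed v‖ ∈ Ioo π vartheta1 := by rwa [hn]
  have hw := sq_mem_regularSet hp
  have p0 := hasFDerivAt_comp_norm_sq (hasDerivAt_psi0 hw)
  have p1 := hasFDerivAt_comp_norm_sq (hasDerivAt_psi1 hw)
  have hG := fun j : Fin 3 => ((((p1.mul (((hasFDerivAt_coord 1 (embed v)).pow 2).add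
    ((hasFDerivAt_coord 2 (embed v)).pow 2))).add (p0.const_mul (if j = 0 then 0 else 1))).mul
    (hasFDerivAt_coord j (embed v))).const_mul (-(2 * c ^ 2))).add_const (4 * t j)
  rw [hessian_eq (G := gradPhi c t) (by
    filter_upwards [eventually_norm_mem_Ioo hp] with τ hτ using hasFDerivAt_phi hτ c t) hG]
  ext i j
  fin_cases i <;> fin_cases j <;>
    simp [PiLp.inner_apply, hn, e0, e1, e2] <;> ring

/-- A symmetric `3 × 3` matrix with negative determinant and a positive eigenvalue has exactly two
positive eigenvalues. -/
lemma card_pos_eigenvalues {H : Matrix (Fin 3) (Fin 3) ℝ} (hH : H.IsHermitian) (hdet : H.det < 0)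
    {μ : ℝ} (hμ : 0 < μ) {x : Fin 3 → ℝ} (hx : x ≠ 0) (hHx : H *ᵥ x = μ • x) :
    (Finset.univ.filter fun i : Fin 3 => 0 < hH.eigenvalues i).card = 2 := by
  have hspec : μ ∈ spectrum ℝ H := by
    rw [spectrum.mem_iff, Matrix.isUnit_iff_isUnit_det, isUnit_iff_ne_zero, not_not,
      ← Matrix.exists_mulVec_eq_zero_iff]
    refine ⟨x, hx, ?_⟩
    rw [Matrix.sub_mulVec, hHx, Algebra.algebraMap_eq_smul_one, Matrix.smul_mulVec,
      Matrix.one_mulVec, sub_self]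
  rw [hH.spectrum_real_eq_range_eigenvalues] at hspec
  obtain ⟨i, hi⟩ := hspec
  rw [← hi] at hμ
  rw [hH.det_eq_prod_eigenvalues, Fin.prod_univ_three] at hdet
  simp only [RCLike.ofReal_real_eq_id, id] at hdet
  generalize hH.eigenvalues = l at *
  rw [Finset.card_filter, Fin.sum_univ_three]
  -- A negative product of three numbers has one or three negative factors; a positive factor
  -- excludes three.
  have key : ∀ a b c : ℝ, a * b * c < 0 → 0 < a ∨ 0 < b ∨ 0 < c →
      ((if 0 < a then 1 else 0) + (if 0 < b then 1 else 0) + (if 0 < c then 1 else 0) : ℕ) = 2 := by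
    intro a b c h h'
    have ha : a ≠ 0 := by rintro rfl; simp at h
    have hb : b ≠ 0 := by rintro rfl; simp at h
    have hc : c ≠ 0 := by rintro rfl; simp at h
    rcases ha.lt_or_gt with ha | ha <;> rcases hb.lt_or_gt with hb | hb <;>
      rcases hc.lt_or_gt with hc | hc
    · rcases h' with h' | h' | h' <;> linarith
    · simp [ha.not_gt, hb.not_gt, hc] at h ⊢
      nlinarith [mul_pos (mul_pos_of_neg_of_neg ha hb) hc]
    · nlinarith [mul_pos_of_neg_of_neg (mul_neg_of_neg_of_pos ha hb) hc]
    · simp [ha.not_gt, hb, hc]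
    · nlinarith [mul_pos_of_neg_of_neg (mul_neg_of_pos_of_neg ha hb) hc]
    · simp [ha, hb.not_gt, hc]
    · simp [ha, hb, hc.not_gt]
    · nlinarith [mul_pos (mul_pos ha hb) hc]
  refine key _ _ _ hdet ?_
  fin_cases i
  · exact Or.inl hμ
  · exact Or.inr (Or.inl hμ)
  · exact Or.inr (Or.inr hμ)

lemma hessian_phi_signature {v : EuclideanSpace ℝ (Fin 2)} (hv : v ∈ OmegaMinusFour) {c : ℝ}
    (hc : 0 < c) (t : EuclideanSpace ℝ (Fin 3)) :
    (hessian (phi (c • EuclideanSpace.single 0 1) t) (embed v)).det ≠ 0 ∧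
      ∃ hH : (hessian (phi (c • EuclideanSpace.single 0 1) t) (embed v)).IsHermitian,
        (Finset.univ.filter fun i : Fin 3 => 0 < hH.eigenvalues i).card = 2 := by
  obtain ⟨hs, -, -, hK⟩ := mem_OmegaMinusFour_iff.1 hv
  have hdet := hess_det_neg hv
  rw [hessian_phi hs]
  generalize 2 * v 1 ^ 2 * (psi1 (‖v‖ ^ 2) + 2 * v 0 ^ 2 * psi2 (‖v‖ ^ 2)) = A at *
  generalize 4 * v 0 * v 1 * (psi1 (‖v‖ ^ 2) + v 1 ^ 2 * psi2 (‖v‖ ^ 2)) = B at *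
  generalize 2 * psi0 (‖v‖ ^ 2) + 10 * v 1 ^ 2 * psi1 (‖v‖ ^ 2) +
    4 * v 1 ^ 4 * psi2 (‖v‖ ^ 2) = C at *
  generalize psi0 (‖v‖ ^ 2) + v 1 ^ 2 * psi1 (‖v‖ ^ 2) = K at *
  have hd : ((-c ^ 2) • !![A, B, 0; B, C, 0; 0, 0, 2 * K]).det < 0 := by
    have e : ((-c ^ 2) • !![A, B, 0; B, C, 0; 0, 0, 2 * K]).det =
        -(2 * c ^ 6 * ((-(A * C - B ^ 2)) * -K)) := by
      simp [Matrix.det_fin_three]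
      ring
    rw [e]
    have := mul_pos (neg_pos.2 hdet) (neg_pos.2 hK)
    exact neg_neg_of_pos (by positivity)
  have hH : ((-c ^ 2) • !![A, B, 0; B, C, 0; 0, 0, 2 * K]).IsHermitian := by
    ext i j
    fin_cases i <;> fin_cases j <;> simp
  -- The third basis vector is an eigenvector, with eigenvalue -c² K₃ > 0.
  refine ⟨hd.ne, hH, card_pos_eigenvalues hH hd (μ := 2 * c ^ 2 * -K) ?_
    (x := Pi.single 2 1) (by simp) ?_⟩
  · have := neg_pos.2 hK
    positivity
  · ext i
    fin_cases i <;> simp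
    ring

end FreeStepTwo

theorem mainTheorem12 :
    ∃ LamInv : EuclideanSpace ℝ (Fin 2) → EuclideanSpace ℝ (Fin 2),
      FreeStepTwo.IsSmoothDiffeoOn FreeStepTwo.Lam LamInv
        FreeStepTwo.OmegaMinusFour FreeStepTwo.R2LtPos ∧
      ∀ c : ℝ, 0 < c → ∀ u ∈ FreeStepTwo.R2LtPos,
        ∀ x t θ : EuclideanSpace ℝ (Fin 3),
          x = c • EuclideanSpace.single 0 1 →
          t = (c ^ 2 / 4) • FreeStepTwo.embed u →
          θ = FreeStepTwo.embed (LamInv u) →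
          ContDiffAt ℝ ∞ (FreeStepTwo.phi x t) θ ∧
          (FreeStepTwo.hessian (FreeStepTwo.phi x t) θ).det ≠ 0 ∧
          ∃ hH : (FreeStepTwo.hessian (FreeStepTwo.phi x t) θ).IsHermitian,
            (Finset.univ.filter fun i : Fin 3 => 0 < hH.eigenvalues i).card = 2 := by
  refine ⟨_, FreeStepTwo.isSmoothDiffeoOn_Lam, ?_⟩
  rintro c hc u hu x t θ rfl - rfl
  have hv := FreeStepTwo.surjOn_Lam.mapsTo_invFunOn hu
  have hn := (FreeStepTwo.mem_OmegaMinusFour_iff.1 hv).1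
  exact ⟨FreeStepTwo.contDiffAt_phi (by rwa [FreeStepTwo.norm_embed]) c t,
    FreeStepTwo.hessian_phi_signature hv hc t⟩
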